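/- Let $\alpha\in(0,1)$ be irrational. For $y\in\mathbb R$ and $\varepsilon,t>0$ let $N_{\alpha,y}(\varepsilon,t)$ be the number of pairs $(p,q)$ with $p\in\mathbb Z$ and $q\in\mathbb N=\{1,2,3,\ldots\}$ such that $$0\le p+q\alpha-y\le\varepsilon\quad\text{and}\quad 0\le q\le t .$$ (i) There is a constant $C>0$, depending only on $\alpha$, such that the following holds. Let $\phi:(0,\infty)\to(0,1)$ be any non-increasing function with $q\,|p+q\alpha|\ge\phi(q)$ for all $(p,q)\in\mathbb Z\times\mathbb N$. Let $y\in\mathbb R$, and let $\varepsilon,t$ be real numbers with $\varepsilon t>4$ and $0<\varepsilon<\sqrt\alpha$. Put $$E:=\frac{\varepsilon t}{\phi\bigl(4t\sqrt{\varepsilon t}\bigr)},\qquad E':=168\sqrt{\varepsilon t^{3}}\;E .$$ Then $$\bigl|N_{\alpha,y}(\varepsilon,t)-\varepsilon t\bigr|\le C\,\frac{\log E}{\phi(E')^{2}} .$$ (ii) In particular, if $\alpha$ is badly approximable, that is, if there is $c>0$ such that for every integer $q\ge1$ the distance from $q\alpha$ to the nearest integer is at least $c/q$, then there is a constant $C>0$,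 depending only on $\alpha$, such that for all $y\in\mathbb R$ and all real $\varepsilon,t$ with $\varepsilon t>4$ and $0<\varepsilon<\sqrt\alpha$, $$\bigl|N_{\alpha,y}(\varepsilon,t)-\varepsilon t\bigr|\le C\log(\varepsilon t).$$ -/

import Mathlib

/-- The pairs `(p, q)` of an integer and a positive integer with
`0 ≤ p + q α - y ≤ ε` and `0 ≤ q ≤ t`. -/
def approxPairs (α y ε t : ℝ) : Set (ℤ × ℕ+) :=
  {x | (0 ≤ (x.1 : ℝ) + ((x.2 : ℕ) : ℝ) * α - y ∧ (x.1 : ℝ) + ((x.2 : ℕ) : ℝ) * α - y ≤ ε) ∧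
    (0 ≤ ((x.2 : ℕ) : ℝ) ∧ ((x.2 : ℕ) : ℝ) ≤ t)}

/-- There are only finitely many such pairs, so that counting them with `Set.ncard` is sound. -/
theorem approxPairs_finite (α y ε t : ℝ) : (approxPairs α y ε t).Finite := by
  have hB : ((Set.Icc ⌊y - t * |α|⌋ ⌈y + ε + t * |α|⌉) ×ˢ
      (Set.Iic (⟨⌊t⌋₊ + 1, Nat.succ_pos _⟩ : ℕ+))).Finite :=
    (Set.finite_Icc _ _).prod (Set.finite_Iic _)
  refine hB.subset ?_
  rintro ⟨p, q⟩ ⟨⟨h1, h2⟩, h3, h4⟩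
  change 0 ≤ (p : ℝ) + ((q : ℕ) : ℝ) * α - y at h1
  change (p : ℝ) + ((q : ℕ) : ℝ) * α - y ≤ ε at h2
  change 0 ≤ ((q : ℕ) : ℝ) at h3
  change ((q : ℕ) : ℝ) ≤ t at h4
  have h5 : |((q : ℕ) : ℝ) * α| ≤ t * |α| := by
    rw [abs_mul, abs_of_nonneg h3]
    exact mul_le_mul_of_nonneg_right h4 (abs_nonneg _)
  obtain ⟨h6, h7⟩ := abs_le.mp h5
  refine ⟨⟨?_, ?_⟩, ?_⟩
  · have : (⌊y - t * |α|⌋ : ℝ) ≤ p := (Int.floor_le _).trans (by linarith)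
    exact_mod_cast this
  · have : (p : ℝ) ≤ ⌈y + ε + t * |α|⌉ := le_trans (by linarith) (Int.le_ceil _)
    exact_mod_cast this
  · have : (q : ℕ) ≤ ⌊t⌋₊ := Nat.le_floor h4
    exact PNat.coe_le_coe _ _ |>.mp (this.trans (Nat.le_succ _))

/-- The counting function `N_{α,y}(ε,t)`. -/
noncomputable def approxCount (α y ε t : ℝ) : ℕ := (approxPairs α y ε t).ncard

/-- `φ` restricts to a non-increasing function `(0, ∞) → (0, 1)` with `q |p + q α| ≥ φ q` for all
integers `p` and all positive integers `q`. -/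
structure IsApproxLowerBound (α : ℝ) (φ : ℝ → ℝ) : Prop where
  mapsTo : Set.MapsTo φ (Set.Ioi 0) (Set.Ioo 0 1)
  antitoneOn : AntitoneOn φ (Set.Ioi 0)
  le_mul_abs : ∀ (p : ℤ) (q : ℕ+), φ ((q : ℕ) : ℝ) ≤ ((q : ℕ) : ℝ) * |(p : ℝ) + ((q : ℕ) : ℝ) * α|

/-- `α` is badly approximable: for some `C > 0`, the distance from `q α` to the nearest integer
is at least `C / q` for every integer `q ≥ 1`. -/
def IsBadlyApproximable (α : ℝ) : Prop :=
  ∃ C : ℝ, 0 < C ∧ ∀ q : ℕ, 1 ≤ q → C / (q : ℝ) ≤ |(q : ℝ) * α - (round ((q : ℝ) * α) : ℝ)|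

/-- `E = ε t / φ(4 t √(ε t))`. -/
noncomputable def errE (φ : ℝ → ℝ) (ε t : ℝ) : ℝ :=
  ε * t / φ (4 * t * Real.sqrt (ε * t))

/-- `E' = 168 √(ε t³) E`. -/
noncomputable def errE' (φ : ℝ → ℝ) (ε t : ℝ) : ℝ :=
  168 * Real.sqrt (ε * t ^ 3) * errE φ ε t

/-! If `p / q` is reduced and within `1 / q²` of `α`, then `q (m + j α)` differs by at most `1` from
the integer `m q + j p`, and these integers for `j < q` run through `ℤ` once. So a block of `q`
consecutive `j` has discrepancy `O(1)` for every `y` (`abs_windowCount_block_sub_le`). If `q' ‖q' α‖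
≥ δ` for `q' ≤ R`, Dirichlet gives such a `q` in `[δ R, R]`: at most `1 / δ` blocks fit in `R`, and
the remainder is at most `R / 2`. Iterating until `ε R ≤ 1` takes `O(log (ε t))` rounds, not `O(log
t)`, each costing `O(1 / δ)`. Part (i) takes `δ = φ(E')`, part (ii) a constant. -/

/-! ### Window counts -/

/-- The number of pairs `(m, j)` with `m ∈ ℤ`, `j < R` and `y ≤ m + j α ≤ y + ε`. -/
noncomputable def windowCount (α y ε : ℝ) (R : ℕ) : ℕ :=
  ∑ j ∈ Finset.range R, (Finset.Icc ⌈y - j * α⌉ ⌊y + ε - j * α⌋).card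

theorem windowCount_add (α y ε : ℝ) (R S : ℕ) :
    windowCount α y ε (R + S) = windowCount α y ε R + windowCount α (y - R * α) ε S := by
  unfold windowCount
  rw [Finset.sum_range_add]
  congr 1
  refine Finset.sum_congr rfl fun j _ => ?_
  congr 3 <;> push_cast <;> ring

theorem windowCount_mono (α y ε : ℝ) {R S : ℕ} (h : R ≤ S) :
    windowCount α y ε R ≤ windowCount α y ε S := by
  obtain ⟨d, rfl⟩ := Nat.exists_eq_add_of_le h
  rw [windowCount_add]
  exact Nat.le_add_right _ _

theorem card_Icc_ceil_floor_le {a b : ℝ} (h : a ≤ b + 1) :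
    ((Finset.Icc ⌈a⌉ ⌊b⌋).card : ℝ) ≤ b - a + 1 := by
  rw [Int.card_Icc]
  rcases le_total 0 (⌊b⌋ + 1 - ⌈a⌉) with h0 | h0
  · have : (((⌊b⌋ + 1 - ⌈a⌉).toNat : ℤ) : ℝ) = ((⌊b⌋ + 1 - ⌈a⌉ : ℤ) : ℝ) := by
      rw [Int.toNat_of_nonneg h0]
    push_cast at this
    rw [this]
    linarith [Int.floor_le b, Int.le_ceil a]
  · rw [Int.toNat_of_nonpos h0]
    push_cast
    linarith

theorem sub_one_le_card_Icc_ceil_floor (a b : ℝ) :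
    b - a - 1 ≤ ((Finset.Icc ⌈a⌉ ⌊b⌋).card : ℝ) := by
  rw [Int.card_Icc]
  have : ((⌊b⌋ + 1 - ⌈a⌉ : ℤ) : ℝ) ≤ (((⌊b⌋ + 1 - ⌈a⌉).toNat : ℤ) : ℝ) := by
    exact_mod_cast Int.self_le_toNat _
  push_cast at this
  linarith [Int.lt_floor_add_one b, Int.ceil_lt_add_one a]

theorem windowCount_eq_card_sigma (α y ε : ℝ) (R : ℕ) :
    windowCount α y ε R = ((Finset.range R).sigma
      fun j : ℕ => Finset.Icc ⌈y - j * α⌉ ⌊y + ε - j * α⌋).card := by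
  rw [Finset.card_sigma, windowCount]

/-! ### Discrepancy of blocks -/

theorem abs_mul_add_sub_le_one {α : ℝ} {q : ℕ} {p : ℤ} (hq : 0 < q)
    (hqp : |q * α - p| ≤ 1 / q) {j : ℕ} (hj : j < q) (m : ℤ) :
    |q * (m + j * α) - (m * q + j * p)| ≤ 1 := by
  have hq' : (0 : ℝ) < q := by exact_mod_cast hq
  have hj' : (j : ℝ) ≤ q := by exact_mod_cast hj.le
  have : (q : ℝ) * (m + j * α) - (m * q + j * p) = j * (q * α - p) := by ring
  rw [this, abs_mul, Nat.abs_cast]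
  calc (j : ℝ) * |q * α - p| ≤ q * (1 / q) := by gcongr
    _ = 1 := by field_simp

/-- A block of `q` consecutive multiples of `α` is equidistributed up to an error of `3`
when `q` is the denominator of a reduced fraction `p / q` close to `α`. -/
theorem abs_windowCount_block_sub_le {α ε : ℝ} (hε : 0 ≤ ε) {q : ℕ} {p : ℤ} (hq : 0 < q)
    (hcop : IsCoprime p (q : ℤ)) (hqp : |q * α - p| ≤ 1 / q) (y : ℝ) :
    |(windowCount α y ε q : ℝ) - ε * q| ≤ 3 := by
  have hq' : (0 : ℝ) < q := by exact_mod_cast hq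
  have hqz : (0 : ℤ) < q := by exact_mod_cast hq
  have hεq : 0 ≤ ε * q := by positivity
  have hupper : (windowCount α y ε q : ℝ) ≤ ε * q + 3 := by
    have hcard : windowCount α y ε q ≤
        (Finset.Icc ⌈q * y - 1⌉ ⌊q * y + q * ε + 1⌋).card := by
      rw [windowCount_eq_card_sigma]
      -- Injective: equal values force `q ∣ j - j'` by coprimality, and `|j - j'| < q`. The slack
      -- `1` at each end plus `1` for rounding makes the `3`.
      refine Finset.card_le_card_of_injOn (fun x => x.2 * q + x.1 * p) ?_ ?_
      · rintro ⟨j, m⟩ h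
        simp only [Finset.coe_sigma, Set.mem_sigma_iff, Finset.mem_coe, Finset.mem_range,
          Finset.mem_Icc, Int.ceil_le, Int.le_floor] at h ⊢
        obtain ⟨hj, h1, h2⟩ := h
        obtain ⟨h3, h4⟩ := abs_le.mp (abs_mul_add_sub_le_one hq hqp hj m)
        have h5 : (q : ℝ) * y ≤ q * (m + j * α) :=
          mul_le_mul_of_nonneg_left (by linarith) hq'.le
        have h6 : (q : ℝ) * (m + j * α) ≤ q * (y + ε) :=
          mul_le_mul_of_nonneg_left (by linarith) hq'.le
        push_cast
        constructor <;> linarith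
      · rintro ⟨j, m⟩ h ⟨j', m'⟩ h' heq
        simp only [Finset.coe_sigma, Set.mem_sigma_iff, Finset.mem_coe, Finset.mem_range]
          at h h' heq
        have hdvd : (q : ℤ) ∣ (j - j' : ℤ) * p := ⟨m' - m, by linear_combination heq⟩
        have hdvd' : (q : ℤ) ∣ (j - j' : ℤ) := hcop.symm.dvd_of_dvd_mul_right hdvd
        have hjj : (j : ℤ) - j' = 0 := by
          refine Int.eq_zero_of_abs_lt_dvd hdvd' ?_
          rw [abs_lt]
          omega
        obtain rfl : j = j' := by omega
        have : m * (q : ℤ) = m' * q := by linarith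
        obtain rfl := mul_right_cancel₀ hqz.ne' this
        rfl
    have := card_Icc_ceil_floor_le (a := q * y - 1) (b := q * y + q * ε + 1) (by linarith)
    have hcard' : (windowCount α y ε q : ℝ) ≤
      ((Finset.Icc ⌈q * y - 1⌉ ⌊q * y + q * ε + 1⌋).card : ℝ) := by exact_mod_cast hcard
    linarith
  have hlower : ε * q - 3 ≤ (windowCount α y ε q : ℝ) := by
    have hcard : (Finset.Icc ⌈q * y + 1⌉ ⌊q * y + q * ε - 1⌋).card ≤ windowCount α y ε q := by
      rw [windowCount_eq_card_sigma]
      refine Finset.card_le_card_of_surjOn (fun x => x.2 * q + x.1 * p) ?_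
      intro N hN
      simp only [Finset.coe_Icc, Set.mem_Icc, Int.ceil_le, Int.le_floor] at hN
      -- From `u p + v q = 1`, the preimage of `N` has `j = N u mod q`.
      obtain ⟨u, v, huv⟩ := hcop
      have hr0 := Int.emod_nonneg (N * u) hqz.ne'
      have hrq := Int.emod_lt_of_pos (N * u) hqz
      obtain ⟨j, hj⟩ := Int.eq_ofNat_of_zero_le hr0
      have hjq : j < q := by omega
      have hdiv := Int.emod_add_mul_ediv (N * u) q
      rw [hj] at hdiv
      have hNeq : (N * v + N * u / q * p) * (q : ℤ) + j * p = N := by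
        linear_combination N * huv + p * hdiv
      have hNeq' : (((N * v + N * u / q * p : ℤ) : ℝ)) * q + j * p = N := by
        exact_mod_cast hNeq
      refine ⟨⟨j, N * v + N * u / q * p⟩, ?_, hNeq⟩
      obtain ⟨h3, h4⟩ :=
        abs_le.mp (abs_mul_add_sub_le_one hq hqp hjq (N * v + N * u / q * p))
      rw [hNeq'] at h3 h4
      simp only [Finset.coe_sigma, Set.mem_sigma_iff, Finset.mem_coe, Finset.mem_range,
        Finset.mem_Icc, Int.ceil_le, Int.le_floor]
      refine ⟨hjq, ?_, ?_⟩
      · have : y ≤ ((N * v + N * u / q * p : ℤ) : ℝ) + j * α :=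
          le_of_mul_le_mul_left (by linarith) hq'
        linarith
      · have : ((N * v + N * u / q * p : ℤ) : ℝ) + j * α ≤ y + ε :=
          le_of_mul_le_mul_left (by linarith) hq'
        linarith
    have := sub_one_le_card_Icc_ceil_floor (q * y + 1) (q * y + q * ε - 1)
    have hcard' : ((Finset.Icc ⌈q * y + 1⌉ ⌊q * y + q * ε - 1⌋).card : ℝ) ≤
      (windowCount α y ε q : ℝ) := by exact_mod_cast hcard
    linarith
  rw [abs_le]
  constructor <;> linarith

theorem abs_windowCount_mul_add_sub_le {α ε : ℝ} (hε : 0 ≤ ε) {q : ℕ} {p : ℤ} (hq : 0 < q)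
    (hcop : IsCoprime p (q : ℤ)) (hqp : |q * α - p| ≤ 1 / q) (r : ℕ) {B : ℝ}
    (hB : ∀ y, |(windowCount α y ε r : ℝ) - ε * r| ≤ B) (b : ℕ) :
    ∀ y, |(windowCount α y ε (q * b + r) : ℝ) - ε * (q * b + r : ℕ)| ≤ 3 * b + B := by
  induction b with
  | zero => simpa using hB
  | succ b ih =>
    intro y
    have h1 := abs_le.mp (abs_windowCount_block_sub_le hε hq hcop hqp y)
    have h2 := abs_le.mp (ih (y - q * α))
    -- Peeling off a block shifts `y`, so the bounds must be uniform in `y`.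
    rw [show q * (b + 1) + r = q + (q * b + r) by ring, windowCount_add, abs_le]
    push_cast at h2 ⊢
    constructor <;> linarith [h1.1, h1.2, h2.1, h2.2]

/-! ### Dirichlet denominators and halving -/

/-- Dirichlet approximation with a lower bound on the denominator. -/
theorem exists_isCoprime_abs_sub_le {α δ : ℝ} {R : ℕ} (hR : 0 < R) (hδ : 0 < δ)
    (h : ∀ (p : ℤ) (q : ℕ), 0 < q → q ≤ R → δ ≤ q * |p + q * α|) :
    ∃ (q : ℕ) (p : ℤ), 0 < q ∧ q ≤ R ∧ IsCoprime p (q : ℤ) ∧ |q * α - p| ≤ 1 / q ∧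
      δ * R ≤ q := by
  obtain ⟨x, hx, hxR⟩ := Real.exists_rat_abs_sub_le_and_den_le α hR
  have hd : (0 : ℝ) < x.den := by exact_mod_cast x.den_pos
  have hR' : (0 : ℝ) < R := by exact_mod_cast hR
  have hxR' : (x.den : ℝ) ≤ R := by exact_mod_cast hxR
  have hle : |x.den * α - x.num| ≤ 1 / (R + 1) := by
    have hxe : (x.den : ℝ) * α - x.num = x.den * (α - x) := by
      rw [mul_sub]
      congr 1
      exact_mod_cast (Rat.den_mul_eq_num x).symm
    rw [hxe, abs_mul, Nat.abs_cast]
    calc (x.den : ℝ) * |α - x| ≤ x.den * (1 / ((R + 1) * x.den)) := by gcongr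
      _ = 1 / (R + 1) := by field_simp
  refine ⟨x.den, x.num, x.den_pos, hxR, ?_, ?_, ?_⟩
  · rw [Int.isCoprime_iff_nat_coprime]
    simpa using x.reduced
  · exact hle.trans (by gcongr; linarith)
  · have h1 := h (-x.num) x.den x.den_pos hxR
    rw [show ((-x.num : ℤ) : ℝ) + x.den * α = x.den * α - x.num by push_cast; ring] at h1
    have h2 : δ ≤ x.den * (1 / (R + 1)) := h1.trans (by gcongr)
    rw [mul_one_div, le_div_iff₀ (by positivity)] at h2
    nlinarith

/-- Each round halves `ε R`, so `k` rounds reach `ε R ≤ 1`; a round costs `3 / δ`, the last stage `8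
/ δ`. -/
theorem abs_windowCount_sub_le {α ε δ : ℝ} (hε : 0 ≤ ε) (hδ : 0 < δ) (k : ℕ) :
    ∀ R : ℕ, (∀ (p : ℤ) (q : ℕ), 0 < q → q ≤ R → δ ≤ q * |p + q * α|) → ε * R ≤ 2 ^ k →
      ∀ y, |(windowCount α y ε R : ℝ) - ε * R| ≤ (8 + 3 * k) / δ := by
  induction k with
  | zero =>
    intro R h hR y
    rcases Nat.eq_zero_or_pos R with rfl | hR0
    · simp only [windowCount, Finset.range_zero, Finset.sum_empty, Nat.cast_zero, mul_zero,
        sub_zero, abs_zero]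
      positivity
    obtain ⟨q, p, hq, hqR, hcop, hqp, hδq⟩ := exists_isCoprime_abs_sub_le hR0 hδ h
    have hq' : (0 : ℝ) < q := by exact_mod_cast hq
    have hqR' : (q : ℝ) ≤ R := by exact_mod_cast hqR
    have hεq : ε * q ≤ 1 := by
      have : ε * q ≤ ε * R := by gcongr
      simp only [pow_zero] at hR
      linarith
    have hb1 : (1 : ℝ) ≤ (R / q : ℕ) := by exact_mod_cast Nat.div_pos hqR hq
    have hbδ : ((R / q : ℕ) : ℝ) ≤ 1 / δ := by
      rw [le_div_iff₀ hδ]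
      have h1 : (((R / q : ℕ) : ℝ)) * q ≤ R := by exact_mod_cast Nat.div_mul_le_self R q
      refine le_of_mul_le_mul_right (a := (q : ℝ)) ?_ hq'
      nlinarith
    -- With `b = R / q ≥ 1`, one extra block covers `R`; since `ε q ≤ 1`, the count is at most `4 (b
    -- + 1) ≤ 8 b ≤ 8 / δ`.
    have hmono : (windowCount α y ε R : ℝ) ≤ windowCount α y ε (q * (R / q + 1) + 0) := by
      exact_mod_cast windowCount_mono α y ε (Nat.lt_mul_div_succ R hq).le
    have hmul := abs_le.mp (abs_windowCount_mul_add_sub_le hε hq hcop hqp 0 (B := 0)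
      (by simp [windowCount]) (R / q + 1) y)
    have h8 : (8 + 3 * ((0 : ℕ) : ℝ)) / δ = 8 * (1 / δ) := by push_cast; ring
    have h9 : ε * q * ((R / q : ℕ) + 1 : ℝ) ≤ 1 * ((R / q : ℕ) + 1 : ℝ) := by gcongr
    have h10 : 0 ≤ ε * R := by positivity
    have h11 : (0 : ℝ) ≤ windowCount α y ε R := Nat.cast_nonneg _
    have h12 := hmul.2
    push_cast [-Nat.cast_div_charZero] at h12
    simp only [pow_zero] at hR
    rw [h8, abs_le]
    constructor <;> linarith
  | succ k ih =>
    intro R h hR y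
    rcases Nat.eq_zero_or_pos R with rfl | hR0
    · simp only [windowCount, Finset.range_zero, Finset.sum_empty, Nat.cast_zero, mul_zero,
        sub_zero, abs_zero]
      positivity
    obtain ⟨q, p, hq, hqR, hcop, hqp, hδq⟩ := exists_isCoprime_abs_sub_le hR0 hδ h
    have hq' : (0 : ℝ) < q := by exact_mod_cast hq
    have hbδ : ((R / q : ℕ) : ℝ) ≤ 1 / δ := by
      rw [le_div_iff₀ hδ]
      have h1 : (((R / q : ℕ) : ℝ)) * q ≤ R := by exact_mod_cast Nat.div_mul_le_self R q
      refine le_of_mul_le_mul_right (a := (q : ℝ)) ?_ hq'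
      nlinarith
    have hdm := Nat.div_add_mod R q
    have hr : 2 * (R % q) ≤ R := by
      have h1 := Nat.mod_lt R hq
      have h2 : q * 1 ≤ q * (R / q) := Nat.mul_le_mul_left q (Nat.div_pos hqR hq)
      omega
    have hr' : 2 * ((R % q : ℕ) : ℝ) ≤ R := by exact_mod_cast hr
    have hεr : ε * (R % q : ℕ) ≤ 2 ^ k := by
      rw [pow_succ] at hR
      nlinarith
    have := abs_windowCount_mul_add_sub_le hε hq hcop hqp (R % q)
      (ih (R % q) (fun p q' h0 h1 => h p q' h0 (h1.trans (Nat.mod_le R q))) hεr) (R / q) y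
    rw [hdm] at this
    have h8 : (8 + 3 * ((k + 1 : ℕ) : ℝ)) / δ = 3 * (1 / δ) + (8 + 3 * k) / δ := by
      push_cast; ring
    rw [h8]
    linarith

/-! ### Back to the original count -/

theorem approxCount_eq_windowCount (α y ε t : ℝ) (ht : 0 ≤ t) :
    approxCount α y ε t = windowCount α (y - α) ε ⌊t⌋₊ := by
  rw [windowCount_eq_card_sigma, approxCount, ← Set.ncard_coe_finset]
  -- Here `q ≥ 1` but `j ≥ 0`: put `j = q - 1` and absorb one `α` into `y`.
  refine Set.ncard_congr (fun x _ => ⟨(x.2 : ℕ) - 1, x.1⟩) ?_ ?_ ?_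
  · rintro ⟨p, q⟩ ⟨⟨h1, h2⟩, -, h4⟩
    have hq : 1 ≤ (q : ℕ) := q.2
    have hqt : (q : ℕ) ≤ ⌊t⌋₊ := Nat.le_floor h4
    simp only [Finset.coe_sigma, Set.mem_sigma_iff, Finset.mem_coe, Finset.mem_range,
      Finset.mem_Icc, Int.ceil_le, Int.le_floor, Nat.cast_sub hq] at h1 h2 ⊢
    push_cast
    refine ⟨by omega, by linarith, by linarith⟩
  · rintro ⟨p, q⟩ ⟨p', q'⟩ - - heq
    simp only [Sigma.mk.injEq, heq_eq_eq] at heq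
    have : (q : ℕ) = q' := by
      have h1 : 1 ≤ (q : ℕ) := q.2
      have h2 : 1 ≤ (q' : ℕ) := q'.2
      omega
    exact Prod.ext heq.2 (PNat.coe_injective this)
  · rintro ⟨j, m⟩ h
    simp only [Finset.coe_sigma, Set.mem_sigma_iff, Finset.mem_coe, Finset.mem_range,
      Finset.mem_Icc, Int.ceil_le, Int.le_floor] at h
    obtain ⟨hj, h1, h2⟩ := h
    have hjt : ((j + 1 : ℕ) : ℝ) ≤ t := (Nat.le_floor_iff ht).mp hj
    push_cast at hjt
    refine ⟨⟨m, j.succPNat⟩, ⟨⟨?_, ?_⟩, ?_, ?_⟩, ?_⟩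
    · simp only [Nat.succPNat_coe, Nat.succ_eq_add_one]; push_cast; linarith
    · simp only [Nat.succPNat_coe, Nat.succ_eq_add_one]; push_cast; linarith
    · positivity
    · simpa using hjt
    · simp

/-- Discrepancy bound in terms of a lower bound for `q ‖q α‖` up to `q ≤ t`. -/
theorem abs_approxCount_sub_le {α δ y ε t : ℝ} (hδ : 0 < δ) (hδ1 : δ ≤ 1)
    (h : ∀ (p : ℤ) (q : ℕ), 0 < q → (q : ℝ) ≤ t → δ ≤ q * |p + q * α|)
    (hεt : 4 < ε * t) (hε : 0 < ε) (hε1 : ε ≤ 1) :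
    |(approxCount α y ε t : ℝ) - ε * t| ≤ 20 * (Real.log (ε * t) / δ) := by
  have ht : 0 < t := by
    by_contra! ht
    nlinarith
  have hft := Nat.floor_le ht.le
  have hft' := Nat.lt_floor_add_one t
  have hlog2 := Real.log_two_gt_d9
  have hlog4 : 2 * Real.log 2 ≤ Real.log (ε * t) := by
    have : Real.log 4 = 2 * Real.log 2 := by
      rw [show (4 : ℝ) = 2 ^ 2 by norm_num, Real.log_pow]; norm_num
    rw [← this]
    exact Real.log_le_log (by norm_num) hεt.le
  set L := Real.log (ε * t) with hL
  set k := ⌈L / Real.log 2⌉₊ with hk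
  have hkL : L / Real.log 2 ≤ k := Nat.le_ceil _
  have hL0 : 0 ≤ L / Real.log 2 := div_nonneg (by linarith) (by linarith)
  have hkU : (k : ℝ) < L / Real.log 2 + 1 := Nat.ceil_lt_add_one hL0
  have hLdiv : L / Real.log 2 ≤ 2 * L := by
    rw [div_le_iff₀ (by linarith)]
    nlinarith
  have hpow : ε * t ≤ 2 ^ k := by
    rw [div_le_iff₀ (by linarith), ← Real.log_pow] at hkL
    exact (Real.log_le_log_iff (by linarith) (by positivity)).mp hkL
  have hmain := abs_windowCount_sub_le hε.le hδ k ⌊t⌋₊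
    (fun p q h0 h1 => h p q h0 ((Nat.le_floor_iff ht.le).mp h1))
    (le_trans (by gcongr) hpow) (y - α)
  rw [← approxCount_eq_windowCount α y ε t ht.le] at hmain
  have hone : 1 ≤ 1 / δ := by rw [le_div_iff₀ hδ]; linarith
  have hfinal : (8 + 3 * (k : ℝ)) / δ + 1 ≤ 20 * (L / δ) := by
    have h1 : (8 + 3 * (k : ℝ)) / δ + 1 ≤ (9 + 3 * k) * (1 / δ) := by
      have : (8 + 3 * (k : ℝ)) / δ = (8 + 3 * k) * (1 / δ) := by ring
      linarith
    have h2 : (9 + 3 * (k : ℝ)) * (1 / δ) ≤ (20 * L) * (1 / δ) := by gcongr; linarith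
    have h3 : 20 * (L / δ) = (20 * L) * (1 / δ) := by ring
    linarith
  have hdiff : |ε * (⌊t⌋₊ : ℝ) - ε * t| ≤ 1 := by
    rw [abs_le]
    constructor <;> nlinarith
  calc |(approxCount α y ε t : ℝ) - ε * t|
      ≤ |(approxCount α y ε t : ℝ) - ε * ⌊t⌋₊| + |ε * (⌊t⌋₊ : ℝ) - ε * t| :=
        abs_sub_le _ _ _
    _ ≤ 20 * (L / δ) := by linarith

theorem corollary4 (α : ℝ) (hα : Irrational α) (hα0 : 0 < α) (hα1 : α < 1) :
    (∃ C : ℝ, 0 < C ∧ ∀ φ : ℝ → ℝ, IsApproxLowerBound α φ →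
      ∀ y ε t : ℝ, 4 < ε * t → 0 < ε → ε < Real.sqrt α →
        |(approxCount α y ε t : ℝ) - ε * t| ≤
          C * (Real.log (errE φ ε t) / φ (errE' φ ε t) ^ 2)) ∧
    (IsBadlyApproximable α →
      ∃ C : ℝ, 0 < C ∧ ∀ y ε t : ℝ, 4 < ε * t → 0 < ε → ε < Real.sqrt α →
        |(approxCount α y ε t : ℝ) - ε * t| ≤ C * Real.log (ε * t)) := by
  have hsqrt : Real.sqrt α ≤ 1 := Real.sqrt_le_one.mpr hα1.le
  refine ⟨⟨20, by norm_num, ?_⟩, ?_⟩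
  · intro φ hφ y ε t hεt hε hεα
    have ht : 0 < t := by
      by_contra! ht
      nlinarith
    have hs : 2 ≤ Real.sqrt (ε * t) := Real.le_sqrt_of_sq_le (by linarith)
    have hφ1 := hφ.mapsTo (show 4 * t * Real.sqrt (ε * t) ∈ Set.Ioi 0 by
      simp only [Set.mem_Ioi]; positivity)
    have hE : ε * t ≤ errE φ ε t := by
      rw [errE, le_div_iff₀ hφ1.1]
      nlinarith [hφ1.2]
    -- As `φ` is non-increasing, this makes `φ(E')` a valid `δ` for all `q ≤ t`.
    have hE' : t ≤ errE' φ ε t := by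
      have h1 : Real.sqrt (ε * t ^ 3) = t * Real.sqrt (ε * t) := by
        rw [show ε * t ^ 3 = t ^ 2 * (ε * t) by ring, Real.sqrt_mul (by positivity),
          Real.sqrt_sq ht.le]
      have h2 : t * 1 ≤ t * Real.sqrt (ε * t) := by gcongr; linarith
      have h3 : (168 * t) * 1 ≤ 168 * (t * Real.sqrt (ε * t)) * errE φ ε t := by
        gcongr <;> linarith
      rw [errE', h1]
      linarith
    have hφ2 := hφ.mapsTo (show errE' φ ε t ∈ Set.Ioi 0 from ht.trans_le hE')
    have hmain := abs_approxCount_sub_le (α := α) (y := y) hφ2.1 hφ2.2.le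
      (fun p q hq hqt => (hφ.antitoneOn (Set.mem_Ioi.mpr (by exact_mod_cast hq))
        (Set.mem_Ioi.mpr (ht.trans_le hE')) (hqt.trans hE')).trans (hφ.le_mul_abs p ⟨q, hq⟩))
      hεt hε (hεα.le.trans hsqrt)
    refine hmain.trans ?_
    have hlog : Real.log (ε * t) ≤ Real.log (errE φ ε t) :=
      Real.log_le_log (by linarith) hE
    have hlog0 : 0 ≤ Real.log (ε * t) := Real.log_nonneg (by linarith)
    have hsq : φ (errE' φ ε t) ^ 2 ≤ φ (errE' φ ε t) := by nlinarith [hφ2.1, hφ2.2]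
    have hsq0 : 0 < φ (errE' φ ε t) ^ 2 := pow_pos hφ2.1 2
    have hlog1 := hlog0.trans hlog
    gcongr
  · rintro ⟨c, hc, hbad⟩
    -- The discrepancy bound needs `δ ≤ 1`.
    have hδ : 0 < min c 1 := lt_min hc one_pos
    refine ⟨20 / min c 1, by positivity, fun y ε t hεt hε hεα => ?_⟩
    refine (abs_approxCount_sub_le hδ (min_le_right c 1) (fun p q hq _ => ?_) hεt hε
      (hεα.le.trans hsqrt)).trans_eq (by ring)
    have hq' : (0 : ℝ) < q := by exact_mod_cast hq
    have h1 := hbad q hq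
    have h2 := round_le ((q : ℝ) * α) (-p)
    rw [div_le_iff₀ hq'] at h1
    push_cast at h2
    rw [sub_neg_eq_add, add_comm] at h2
    calc min c 1 ≤ c := min_le_left c 1
      _ ≤ |(q : ℝ) * α - (round ((q : ℝ) * α) : ℝ)| * q := h1
      _ ≤ |(p : ℝ) + q * α| * q := by gcongr
      _ = q * |(p : ℝ) + q * α| := mul_comm _ _
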